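/- Say that a random matrix $M\in\mathbb{R}^{m\times n}$ has the $(\varepsilon,\delta)$-Strong JL Moment Property if, for every unit vector $x\in\mathbb{R}^n$, $\mathbb{E}\|Mx\|_2^2=1$ and $$\left(\mathbb{E}\left|\|Mx\|_2^2-1\right|^p\right)^{1/p}\le\frac{\varepsilon}{e}\sqrt{\frac{p}{\log(1/\delta)}}\qquad\text{for all real } p \text{ with } 2\le p\le\log(1/\delta).$$ For matrices $A^{(1)},\dots,A^{(c)}\in\mathbb{R}^{m\times d}$, the face-splitting product $A^{(1)}\bullet\dots\bullet A^{(c)}\in\mathbb{R}^{m\times d^c}$ is the matrix whose $i$-th row is the tensor product $A^{(1)}_i\otimes\dots\otimes A^{(c)}_i$ of the $i$-th rows. **Theorem.** There is an absolute constant $K>0$ with the following property. Let $\varepsilon,\delta\in(0,1]$, let $c,m\ge 1$ and $d\ge 0$ be integers, and let $a>0$. Let $T\in\mathbb{R}^{m\times d}$ be a random matrix with iid rows $T_1,\dots,T_m$ such that, for all $x\in\mathbb{R}^d$ and all real $p\ge 2$, $$\mathbb{E}\,\langle T_1,x\rangle^2=\|x\|_2^2\qquad\text{and}\qquad \left(\mathbb{E}\,|\langle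 T_1,x\rangle|^p\right)^{1/p}\le\sqrt{ap}\,\|x\|_2 .$$ Let $T^{(1)},\dots,T^{(c)}$ be independent copies of $T$, and let $M=\frac{1}{\sqrt m}\,T^{(1)}\bullet\dots\bullet T^{(c)}\in\mathbb{R}^{m\times d^c}$. If $$m\ge K\left[(4a)^{2c}\,\varepsilon^{-2}\log(1/\delta)+(2ae)^{c}\,\varepsilon^{-1}\left(\log(1/\delta)\right)^{c}\right],$$ then $M$ has the $(\varepsilon,\delta)$-Strong JL Moment Property. -/

import Mathlib

open MeasureTheory ProbabilityTheory

/-- The product (Borel) sigma-algebra on real matrices. -/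
instance instMeasurableSpaceRealMatrix {m n : Type*} : MeasurableSpace (Matrix m n ℝ) :=
  inferInstanceAs (MeasurableSpace (m → n → ℝ))

/-- The face-splitting product `A 0 • A 1 • ⋯ • A (c-1)` of `c` matrices of size `m × d`: its `i`-th
row is the tensor product of the `i`-th rows. The `d ^ c` columns are indexed by the multi-indices
`J : Fin c → Fin d`. -/
def faceSplitting {c m d : ℕ} (A : Fin c → Matrix (Fin m) (Fin d) ℝ) :
    Matrix (Fin m) (Fin c → Fin d) ℝ :=
  Matrix.of fun i J => ∏ k, A k i (J k)

/-- The squared Euclidean norm of `A x`. -/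
noncomputable def sqNormMulVec {m : ℕ} {ι : Type*} [Fintype ι] (A : Matrix (Fin m) ι ℝ)
    (x : EuclideanSpace ℝ ι) : ℝ :=
  ‖(WithLp.toLp 2 (A.mulVec (fun j => x j)) : EuclideanSpace ℝ (Fin m))‖ ^ 2

/-- The `(ε, δ)`-Strong JL Moment Property (for `0 < δ`) of a random matrix `M` with columns indexed
by `ι`: for every unit vector `x`, `E ‖M x‖² = 1`, and
`‖ ‖M x‖² - 1 ‖_p ≤ (ε / e) √(p / log (1 / δ))` for all real `p` with `2 ≤ p ≤ log (1 / δ)`.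
The `p`-th moment is taken in `[0, ∞]`, so that the bound contains its finiteness. -/
structure StrongJLMoment {Ω : Type*} [MeasurableSpace Ω] {m : ℕ} {ι : Type*} [Fintype ι]
    (M : Ω → Matrix (Fin m) ι ℝ) (P : Measure Ω) (ε δ : ℝ) : Prop where
  aemeasurable : AEMeasurable M P
  integrable_sq : ∀ x : EuclideanSpace ℝ ι, ‖x‖ = 1 →
    Integrable (fun ω => sqNormMulVec (M ω) x) P
  mean_sq : ∀ x : EuclideanSpace ℝ ι, ‖x‖ = 1 → ∫ ω, sqNormMulVec (M ω) x ∂P = 1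
  moment_le : ∀ x : EuclideanSpace ℝ ι, ‖x‖ = 1 →
    ∀ p : ℝ, 2 ≤ p → p ≤ Real.log (1 / δ) →
      eLpNorm (fun ω => sqNormMulVec (M ω) x - 1) (ENNReal.ofReal p) P ≤
        ENNReal.ofReal (ε / Real.exp 1 * Real.sqrt (p / Real.log (1 / δ)))

/-! Write L = log(1/δ). For a unit vector x, ‖Mx‖² - 1 is the average of m variables Z_i = W_i² - 1,
where W_i pairs x with the tensor product of the i-th rows. The Z_i are independent
(`iIndepFun_swap`) and centered (`lintegral_tensorForm_sq`). Integrating out one tensor factor at a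
time, with Minkowski's inequality between steps, gives ‖W_i²‖_s ≤ (2as)^c
(`lintegral_tensorForm_rpow_le`).

Such tails need not have exponential moments, so the sum is controlled in L^p directly. If E|S|^p ≤
M^p and Y is centered and independent of S, a Taylor bound for |S + Y|^p has no linear term in
expectation, so adding Y multiplies the bound M^p by at most 1 + `momentIncrement` at scale M. Once
a scale τ makes every increment at most p/m, all m summands together cost (1 + p/m)^m ≤ e^p, and the
L^p norm of the sum is at most eτ (`integral_abs_sum_rpow_le`). The choice τ = mε√(p/L)/e² then
yields the claim.

It remains to bound the increments (`momentIncrement_le`). After normalisation, the term of order s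
asks for a lower bound on m^(s-1) = m · m^(s-2): the first summand of the hypothesis on m bounds one
factor, the second bounds the other s - 2 (`rpow_moment_term_le`). -/

/-! ### Pointwise Taylor bounds for powers of a sum -/

theorem exp_neg_le_quadratic {x : ℝ} (hx : 0 ≤ x) : Real.exp (-x) ≤ 1 - x + x ^ 2 / 2 := by
  have h := Real.quadratic_le_exp_of_nonneg hx
  have h0 : 0 < 1 - x + x ^ 2 / 2 := by nlinarith [sq_nonneg (x - 1)]
  rw [Real.exp_neg, inv_le_comm₀ (Real.exp_pos x) h0]
  refine le_trans ?_ h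
  rw [inv_le_iff_one_le_mul₀ h0]
  -- The product of the two quadratics is 1 + x⁴/4.
  nlinarith [sq_nonneg (x ^ 2)]

/-- The exponential series truncated at `⌊p⌋`, with a remainder of order `p`. -/
theorem one_add_rpow_le_sum {p y : ℝ} (hp : 0 ≤ p) (hy : 0 ≤ y) :
    (1 + y) ^ p ≤ ∑ k ∈ Finset.range (⌊p⌋₊ + 1), p ^ k / k.factorial * y ^ k
      + Real.exp p * y ^ p := by
  have hsum : 0 ≤ ∑ k ∈ Finset.range (⌊p⌋₊ + 1), p ^ k / k.factorial * y ^ k :=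
    Finset.sum_nonneg fun k _ => by positivity
  rcases le_total y 1 with h1 | h1
  · have hexp : (1 + y) ^ p ≤ Real.exp (p * y) := by
      rw [mul_comm, Real.exp_mul]
      exact Real.rpow_le_rpow (by positivity) (by linarith [Real.add_one_le_exp y]) hp
    refine hexp.trans ?_
    have hs : ∀ x : ℝ, HasSum (fun n : ℕ => x ^ n / n.factorial) (Real.exp x) := fun x => by
      rw [Real.exp_eq_exp_ℝ]; exact NormedSpace.expSeries_div_hasSum_exp x
    rw [← (hs (p * y)).tsum_eq,
      ← (hs (p * y)).summable.sum_add_tsum_nat_add (⌊p⌋₊ + 1)]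
    refine add_le_add (Finset.sum_le_sum fun k _ => by rw [mul_pow]; apply le_of_eq; ring) ?_
    have hshift := (summable_nat_add_iff (⌊p⌋₊ + 1)).2 (hs p).summable
    have hle : ∑' i : ℕ, p ^ (i + (⌊p⌋₊ + 1)) / ((i + (⌊p⌋₊ + 1)).factorial : ℝ) ≤ Real.exp p := by
      rw [← (hs p).tsum_eq, ← (hs p).summable.sum_add_tsum_nat_add (⌊p⌋₊ + 1)]
      exact le_add_of_nonneg_left (Finset.sum_nonneg fun k _ => by positivity)
    refine le_trans ?_ (mul_le_mul_of_nonneg_right hle (Real.rpow_nonneg hy p))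
    rw [← tsum_mul_right]
    refine Summable.tsum_le_tsum (fun i => ?_)
      ((summable_nat_add_iff (⌊p⌋₊ + 1)).2 (hs (p * y)).summable) (hshift.mul_right _)
    rw [mul_pow, mul_div_right_comm]
    refine mul_le_mul_of_nonneg_left ?_ (by positivity)
    -- Every exponent in the tail exceeds p, so y ≤ 1 lets y^p replace each power.
    rcases hy.eq_or_lt with rfl | hy0
    · rw [zero_pow (by omega)]; positivity
    · rw [← Real.rpow_natCast]
      refine Real.rpow_le_rpow_of_exponent_ge hy0 h1 ?_
      have := Nat.lt_floor_add_one p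
      push_cast
      linarith [(Nat.cast_nonneg i : (0 : ℝ) ≤ i)]
  · have h2 : (1 + y) ^ p ≤ (Real.exp 1 * y) ^ p :=
      Real.rpow_le_rpow (by positivity) (by nlinarith [Real.add_one_le_exp (1 : ℝ)]) hp
    rw [Real.mul_rpow (Real.exp_pos 1).le hy, ← Real.exp_mul, one_mul] at h2
    linarith

theorem two_le_floor {p : ℝ} (hp : 2 ≤ p) : 2 ≤ ⌊p⌋₊ := Nat.le_floor (by exact_mod_cast hp)

/-- The linear term keeps its sign, so that it can vanish in expectation. For negative y the term k
= 2 and the remainder already suffice. -/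
theorem abs_one_add_rpow_le {p : ℝ} (hp : 2 ≤ p) (y : ℝ) :
    |1 + y| ^ p ≤ 1 + p * y + ∑ k ∈ Finset.Icc 2 ⌊p⌋₊, p ^ k / k.factorial * |y| ^ k
      + Real.exp p * |y| ^ p := by
  have hp0 : 0 ≤ p := by linarith
  have hfl := two_le_floor hp
  rcases le_total 0 y with hy | hy
  · have h := one_add_rpow_le_sum hp0 hy
    rw [Finset.range_eq_Ico, Finset.sum_eq_sum_Ico_succ_bot (by omega),
      Finset.sum_eq_sum_Ico_succ_bot (by omega)] at h
    have hI : Finset.Ico (0 + 1 + 1) (⌊p⌋₊ + 1) = Finset.Icc 2 ⌊p⌋₊ := by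
      ext k; simp only [Finset.mem_Ico, Finset.mem_Icc]; omega
    rw [hI] at h
    rw [abs_of_nonneg hy, abs_of_nonneg (by positivity)]
    simpa [add_assoc] using h
  · obtain ⟨u, rfl⟩ : ∃ u, y = -u := ⟨-y, by ring⟩
    have hu : 0 ≤ u := by linarith
    have hterm : (p * u) ^ 2 / 2 ≤ ∑ k ∈ Finset.Icc 2 ⌊p⌋₊, p ^ k / k.factorial * |-u| ^ k := by
      have := Finset.single_le_sum (s := Finset.Icc 2 ⌊p⌋₊)
        (f := fun k : ℕ => p ^ k / k.factorial * |-u| ^ k)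
        (fun k _ => by positivity) (Finset.mem_Icc.2 ⟨le_rfl, hfl⟩)
      refine le_trans (le_of_eq ?_) this
      simp [Nat.factorial]; ring
    have hlast : 0 ≤ Real.exp p * |-u| ^ p := by positivity
    rcases le_total u 1 with h1 | h1
    · have h2 : |1 + -u| ^ p ≤ Real.exp (-(p * u)) := by
        rw [show -(p * u) = -u * p by ring, Real.exp_mul, abs_of_nonneg (by linarith)]
        exact Real.rpow_le_rpow (by linarith) (by linarith [Real.add_one_le_exp (-u)]) hp0
      have h3 := exp_neg_le_quadratic (mul_nonneg hp0 hu)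
      linarith
    · have h2 : |1 + -u| ^ p ≤ |-u| ^ p := by
        refine Real.rpow_le_rpow (abs_nonneg _) ?_ hp0
        rw [abs_neg, abs_of_nonneg hu, abs_le]
        constructor <;> linarith
      have h3 : |-u| ^ p ≤ Real.exp p * |-u| ^ p :=
        le_mul_of_one_le_left (by positivity) (Real.one_le_exp hp0)
      nlinarith [sq_nonneg (p * u - 1)]

/-- A Taylor-type bound for `|x + y| ^ p` whose first order term is linear in `y`; the higher order
terms in `x` are bounded by means of an arbitrary scale `M > 0`. -/
theorem abs_add_rpow_le {p M : ℝ} (hp : 2 ≤ p) (hM : 0 < M) (x y : ℝ) :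
    |x + y| ^ p ≤ |x| ^ p + p * (|x| ^ (p - 2) * x) * y
      + (|x| ^ p + M ^ p) * ∑ k ∈ Finset.Icc 2 ⌊p⌋₊, p ^ k / k.factorial * (|y| ^ k / M ^ k)
      + Real.exp p * |y| ^ p := by
  have hp0 : 0 ≤ p := by linarith
  rcases eq_or_ne x 0 with rfl | hx
  · have h3 : |y| ^ p ≤ Real.exp p * |y| ^ p :=
      le_mul_of_one_le_left (by positivity) (Real.one_le_exp hp0)
    have h4 : 0 ≤ (|(0 : ℝ)| ^ p + M ^ p) *
      ∑ k ∈ Finset.Icc 2 ⌊p⌋₊, p ^ k / k.factorial * (|y| ^ k / M ^ k) :=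
      mul_nonneg (by positivity) (Finset.sum_nonneg fun k _ => by positivity)
    have h5 : |(0 : ℝ)| ^ p = 0 := by rw [abs_zero, Real.zero_rpow (by linarith)]
    rw [h5] at h4 ⊢
    simp only [zero_add, mul_zero, zero_mul] at h4 ⊢
    linarith
  · have hx0 : 0 < |x| := abs_pos.2 hx
    have h := mul_le_mul_of_nonneg_left (abs_one_add_rpow_le hp (y / x))
      (Real.rpow_nonneg hx0.le p)
    rw [← Real.mul_rpow hx0.le (abs_nonneg _), ← abs_mul,
      show x * (1 + y / x) = x + y by field_simp] at h
    refine h.trans ?_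
    rw [mul_add, mul_add, mul_add, mul_one, Finset.mul_sum, Finset.mul_sum]
    have h1 : |x| ^ p * (p * (y / x)) = p * (|x| ^ (p - 2) * x) * y := by
      rw [Real.rpow_sub hx0, Real.rpow_two, sq_abs]
      field_simp
    have h2 : |x| ^ p * (Real.exp p * |y / x| ^ p) = Real.exp p * |y| ^ p := by
      rw [abs_div, Real.div_rpow (abs_nonneg _) hx0.le]
      have : |x| ^ p ≠ 0 := (Real.rpow_pos_of_pos hx0 p).ne'
      field_simp
    rw [h1, h2]
    refine add_le_add_left (add_le_add_right (Finset.sum_le_sum fun k hk => ?_) _) _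
    have hkp : (k : ℝ) ≤ p := (Nat.le_floor_iff hp0).1 (Finset.mem_Icc.1 hk).2
    -- This replaces the intermediate power |x|^(p-k) by the p-th power alone: compare |x| with M
    -- and use k ≤ p.
    have h3 : |x| ^ p / |x| ^ k ≤ (|x| ^ p + M ^ p) / M ^ k := by
      rcases le_total |x| M with hxM | hxM
      · have : |x| ^ p / |x| ^ k ≤ M ^ p / M ^ k := by
          rw [← Real.rpow_natCast, ← Real.rpow_natCast, ← Real.rpow_sub hx0, ← Real.rpow_sub hM]
          exact Real.rpow_le_rpow hx0.le hxM (by linarith)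
        refine this.trans ?_
        gcongr
        exact le_add_of_nonneg_left (by positivity)
      · gcongr
        exact le_add_of_nonneg_right (by positivity)
    calc |x| ^ p * (p ^ k / k.factorial * |y / x| ^ k)
        = (p ^ k / k.factorial * |y| ^ k) * (|x| ^ p / |x| ^ k) := by
          rw [abs_div, div_pow]; ring
      _ ≤ (p ^ k / k.factorial * |y| ^ k) * ((|x| ^ p + M ^ p) / M ^ k) := by gcongr
      _ = _ := by ring

/-! ### Moments of sums of independent centered variables -/

section Moments

variable {Ω : Type*} [MeasurableSpace Ω] {P : Measure Ω}

theorem abs_rpow_le_one_add {s p : ℝ} (hs : 0 ≤ s) (hsp : s ≤ p) (x : ℝ) :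
    |x| ^ s ≤ 1 + |x| ^ p := by
  rcases le_total |x| 1 with h | h
  · exact (Real.rpow_le_one (abs_nonneg x) h hs).trans (le_add_of_nonneg_right (by positivity))
  · exact (Real.rpow_le_rpow_of_exponent_le h hsp).trans (le_add_of_nonneg_left zero_le_one)

theorem integrable_abs_rpow_of_le [IsFiniteMeasure P] {X : Ω → ℝ} {s p : ℝ}
    (hX : AEMeasurable X P) (hint : Integrable (fun ω => |X ω| ^ p) P) (hs : 0 ≤ s)
    (hsp : s ≤ p) : Integrable (fun ω => |X ω| ^ s) P := by
  refine ((integrable_const (1 : ℝ)).add hint).mono'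
    ((continuous_abs.measurable.comp_aemeasurable hX).pow_const s).aestronglyMeasurable
    (Filter.Eventually.of_forall fun ω => ?_)
  rw [Real.norm_of_nonneg (by positivity)]
  exact abs_rpow_le_one_add hs hsp (X ω)

/-- The quantity that controls the growth of the `p`-th moment of a sum when a summand `Y` is added
to it, at scale `τ`. -/
noncomputable def momentIncrement (P : Measure Ω) (p τ : ℝ) (Y : Ω → ℝ) : ℝ :=
  2 * ∑ k ∈ Finset.Icc 2 ⌊p⌋₊, p ^ k / k.factorial * ((∫ ω, |Y ω| ^ k ∂P) / τ ^ k)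
    + Real.exp p * ((∫ ω, |Y ω| ^ p ∂P) / τ ^ p)

theorem momentIncrement_anti {p τ M : ℝ} (hp : 0 ≤ p) (hτ : 0 < τ) (hM : τ ≤ M) (Y : Ω → ℝ) :
    momentIncrement P p M Y ≤ momentIncrement P p τ Y := by
  unfold momentIncrement
  have h : ∀ k : ℕ, 0 ≤ ∫ ω, |Y ω| ^ k ∂P := fun k => integral_nonneg fun ω => by positivity
  have h' : 0 ≤ ∫ ω, |Y ω| ^ p ∂P := integral_nonneg fun ω => by positivity
  gcongr

/-- Independence factors the expectation of the Taylor bound and kills its linear term. The factor 2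
in `momentIncrement` comes from E|S|^p + M^p ≤ 2M^p. -/
theorem integral_abs_add_rpow_le [IsProbabilityMeasure P] {p M : ℝ} (hp : 2 ≤ p) (hM : 0 < M)
    {S Y : Ω → ℝ} (hS : AEMeasurable S P) (hY : AEMeasurable Y P) (hind : IndepFun S Y P)
    (hSp : Integrable (fun ω => |S ω| ^ p) P) (hYp : Integrable (fun ω => |Y ω| ^ p) P)
    (hY0 : ∫ ω, Y ω ∂P = 0) (hSM : ∫ ω, |S ω| ^ p ∂P ≤ M ^ p) :
    Integrable (fun ω => |S ω + Y ω| ^ p) P ∧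
      ∫ ω, |S ω + Y ω| ^ p ∂P ≤ M ^ p * (1 + momentIncrement P p M Y) := by
  have hp0 : 0 ≤ p := by linarith
  have hYk : ∀ k ∈ Finset.Icc 2 ⌊p⌋₊, Integrable (fun ω => |Y ω| ^ k) P := fun k hk => by
    have := integrable_abs_rpow_of_le (s := k) hY hYp (by positivity)
      ((Nat.le_floor_iff hp0).1 (Finset.mem_Icc.1 hk).2)
    simpa only [Real.rpow_natCast] using this
  have hY1 : Integrable Y P := by
    have := integrable_abs_rpow_of_le (s := 1) hY hYp zero_le_one (by linarith)
    simp only [Real.rpow_one] at this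
    exact (integrable_norm_iff hY.aestronglyMeasurable).1 this
  set φ : ℝ → ℝ := fun x => p * (|x| ^ (p - 2) * x) with hφ
  set ψ : ℝ → ℝ := fun y => ∑ k ∈ Finset.Icc 2 ⌊p⌋₊, p ^ k / k.factorial * (|y| ^ k / M ^ k) with hψ
  have hφm : Measurable φ := by fun_prop
  have hψm : Measurable ψ := by fun_prop
  have hφi : Integrable (fun ω => φ (S ω)) P := by
    refine ((integrable_abs_rpow_of_le (s := p - 1) hS hSp (by linarith)
      (by linarith)).const_mul p).mono' (hφm.comp_aemeasurable hS).aestronglyMeasurable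
      (Filter.Eventually.of_forall fun ω => ?_)
    rw [hφ, Real.norm_eq_abs, abs_mul, abs_mul, abs_of_nonneg hp0,
      abs_of_nonneg (a := |S ω| ^ (p - 2)) (by positivity)]
    refine mul_le_mul_of_nonneg_left (le_of_eq ?_) hp0
    rcases eq_or_ne (S ω) 0 with h0 | h0
    · rw [h0, abs_zero, mul_zero, Real.zero_rpow (by linarith)]
    · nth_rewrite 2 [← Real.rpow_one |S ω|]
      rw [← Real.rpow_add (abs_pos.2 h0)]
      ring_nf
  have hψi : Integrable (fun ω => ψ (Y ω)) P :=
    integrable_finsetSum _ fun k hk => ((hYk k hk).div_const _).const_mul _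
  have hφψ : IndepFun (fun ω => φ (S ω)) Y P := hind.comp hφm measurable_id
  have hSψ : IndepFun (fun ω => |S ω| ^ p + M ^ p) (fun ω => ψ (Y ω)) P :=
    hind.comp (φ := fun x => |x| ^ p + M ^ p) (by fun_prop) hψm
  have i2 : Integrable (fun ω => φ (S ω) * Y ω) P := hφψ.integrable_mul hφi hY1
  have i3 : Integrable (fun ω => (|S ω| ^ p + M ^ p) * ψ (Y ω)) P :=
    hSψ.integrable_mul (hSp.add (integrable_const _)) hψi
  have i4 : Integrable (fun ω => Real.exp p * |Y ω| ^ p) P := hYp.const_mul _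
  have hbound : ∀ ω, |S ω + Y ω| ^ p ≤
      |S ω| ^ p + φ (S ω) * Y ω + (|S ω| ^ p + M ^ p) * ψ (Y ω) + Real.exp p * |Y ω| ^ p :=
    fun ω => abs_add_rpow_le hp hM (S ω) (Y ω)
  have itot : Integrable (fun ω => |S ω| ^ p + φ (S ω) * Y ω + (|S ω| ^ p + M ^ p) * ψ (Y ω)
      + Real.exp p * |Y ω| ^ p) P := ((hSp.add i2).add i3).add i4
  have i12 : Integrable (fun ω => |S ω| ^ p + φ (S ω) * Y ω) P := hSp.add i2
  have i123 : Integrable (fun ω => |S ω| ^ p + φ (S ω) * Y ω + (|S ω| ^ p + M ^ p) * ψ (Y ω)) P :=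
    i12.add i3
  have hint : Integrable (fun ω => |S ω + Y ω| ^ p) P := by
    refine itot.mono' (((continuous_abs.measurable.comp_aemeasurable
      (hS.add hY)).pow_const p).aestronglyMeasurable) (Filter.Eventually.of_forall fun ω => ?_)
    rw [Real.norm_of_nonneg (by positivity)]
    exact hbound ω
  refine ⟨hint, (integral_mono hint itot hbound).trans ?_⟩
  have e2 : ∫ ω, φ (S ω) * Y ω ∂P = 0 := by
    rw [hφψ.integral_fun_mul_eq_mul_integral hφi.aestronglyMeasurable hY.aestronglyMeasurable,
      hY0, mul_zero]
  have e3 : ∫ ω, (|S ω| ^ p + M ^ p) * ψ (Y ω) ∂P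
      = (∫ ω, |S ω| ^ p ∂P + M ^ p) * ∫ ω, ψ (Y ω) ∂P := by
    rw [hSψ.integral_fun_mul_eq_mul_integral (hSp.add (integrable_const _)).aestronglyMeasurable
      hψi.aestronglyMeasurable, integral_add hSp (integrable_const _)]
    simp
  have e5 : ∫ ω, ψ (Y ω) ∂P
      = ∑ k ∈ Finset.Icc 2 ⌊p⌋₊, p ^ k / k.factorial * ((∫ ω, |Y ω| ^ k ∂P) / M ^ k) := by
    rw [hψ, integral_finsetSum _ fun k hk => ((hYk k hk).div_const _).const_mul _]
    simp only [integral_const_mul, integral_div]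
  have hψ0 : 0 ≤ ∫ ω, ψ (Y ω) ∂P :=
    integral_nonneg fun ω => Finset.sum_nonneg fun k _ => by positivity
  rw [integral_add i123 i4, integral_add i12 i3, integral_add hSp i2,
    e2, e3, integral_const_mul]
  have hMp : 0 < M ^ p := by positivity
  have h1 : (∫ ω, |S ω| ^ p ∂P + M ^ p) * ∫ ω, ψ (Y ω) ∂P
      ≤ (M ^ p + M ^ p) * ∫ ω, ψ (Y ω) ∂P := by gcongr
  calc _ ≤ M ^ p + 0 + (M ^ p + M ^ p) * ∫ ω, ψ (Y ω) ∂P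
        + Real.exp p * ∫ ω, |Y ω| ^ p ∂P := by gcongr
    _ = M ^ p * (1 + momentIncrement P p M Y) := by
        rw [momentIncrement, ← e5]
        field_simp
        ring

/-- A moment inequality of Latała type for sums of independent centered random variables. -/
theorem integral_abs_sum_rpow_le [IsProbabilityMeasure P] {ι : Type*} {p τ b : ℝ} (hp : 2 ≤ p)
    (hτ : 0 < τ) (hb : 0 ≤ b) {X : ι → Ω → ℝ} (hX : ∀ i, AEMeasurable (X i) P)
    (hind : iIndepFun X P) (hXp : ∀ i, Integrable (fun ω => |X i ω| ^ p) P)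
    (hX0 : ∀ i, ∫ ω, X i ω ∂P = 0) (hXb : ∀ i, momentIncrement P p τ (X i) ≤ b)
    (s : Finset ι) :
    Integrable (fun ω => |∑ i ∈ s, X i ω| ^ p) P ∧
      ∫ ω, |∑ i ∈ s, X i ω| ^ p ∂P ≤ τ ^ p * (1 + b) ^ s.card := by
  classical
  have hp0 : 0 < p := by linarith
  induction s using Finset.induction_on with
  | empty =>
    simp only [Finset.sum_empty, abs_zero, Real.zero_rpow hp0.ne', Finset.card_empty, pow_zero,
      mul_one, integral_zero]
    exact ⟨integrable_zero _ _ _, by positivity⟩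
  | insert i s hi ih =>
    have hSi : IndepFun (fun ω => ∑ j ∈ s, X j ω) (X i) P := by
      have h := hind.indepFun_finsetSum_of_notMem₀ hX hi
      have e : (∑ j ∈ s, X j) = fun ω => ∑ j ∈ s, X j ω := by ext ω; simp
      rwa [e] at h
    -- M is the current bound on the L^p norm. It never falls below τ, so the increment at scale M
    -- is at most the one at scale τ.
    set M : ℝ := τ * ((1 + b) ^ s.card) ^ (1 / p) with hMdef
    have hone : 1 ≤ (1 + b) ^ s.card := one_le_pow₀ (by linarith)
    have hτM : τ ≤ M := le_mul_of_one_le_right hτ.le (Real.one_le_rpow hone (by positivity))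
    have hMp : M ^ p = τ ^ p * (1 + b) ^ s.card := by
      rw [hMdef, Real.mul_rpow hτ.le (by positivity), ← Real.rpow_mul (by positivity),
        one_div_mul_cancel hp0.ne', Real.rpow_one]
    have hM0 : 0 < M := hτ.trans_le hτM
    have := integral_abs_add_rpow_le hp hM0
      (Finset.aemeasurable_fun_sum s fun j _ => hX j) (hX i) hSi ih.1 (hXp i) (hX0 i)
      (by rw [hMp]; exact ih.2)
    simp only [Finset.sum_insert hi, add_comm (X i _)]
    refine ⟨this.1, this.2.trans ?_⟩
    rw [Finset.card_insert_of_notMem hi, pow_succ, ← mul_assoc, hMp]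
    have := (momentIncrement_anti (P := P) hp0.le hτ hτM (X i)).trans (hXb i)
    gcongr

end Moments

/-! ### Calibrating the scale against the number of rows -/

/-- The tangent to the logarithm at s = 2; it is what matches the constants 4a and 2ae in the
hypothesis on m. -/
theorem log_le_log_two_add {s : ℝ} (hs : 0 < s) : Real.log s ≤ Real.log 2 + (s / 2 - 1) := by
  have h := Real.log_le_sub_one_of_pos (x := s / 2) (by positivity)
  rw [Real.log_div hs.ne' two_ne_zero] at h
  linarith

/-- The row count `m` dominates the normalised `s`-th moments for all `2 ≤ s ≤ p ≤ L`. -/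
theorem rpow_moment_term_le {ε L a m p s B : ℝ} {c : ℕ} (hε : 0 < ε) (ha : 0 < a) (hc : 1 ≤ c)
    (hB : 1 ≤ B) (hs : 2 ≤ s) (hsp : s ≤ p) (hpL : p ≤ L)
    (hm : B ^ 2 * ((4 * a) ^ (2 * c) * (ε ^ 2)⁻¹ * L
      + (2 * a * Real.exp 1) ^ c * ε⁻¹ * L ^ c) ≤ m) :
    (p / s) ^ s * (2 * a * s) ^ (c * s) * (m / p) ≤ (m * ε * √(p / L) / B) ^ s := by
  have hs0 : 0 < s := by linarith
  have hp0 : 0 < p := by linarith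
  have hL0 : 0 < L := by linarith
  have hB0 : 0 < B := by linarith
  have hc' : (1 : ℝ) ≤ c := by exact_mod_cast hc
  have hα : 0 < 2 * a := by positivity
  rw [show 4 * a = 2 * (2 * a) by ring] at hm
  generalize 2 * a = α at hm hα ⊢
  have h1 : 0 < (2 * α) ^ (2 * c) * (ε ^ 2)⁻¹ * L := by positivity
  have h2 : 0 < (α * Real.exp 1) ^ c * ε⁻¹ * L ^ c := by positivity
  have hm1 : B ^ 2 * ((2 * α) ^ (2 * c) * (ε ^ 2)⁻¹ * L) ≤ m := by nlinarith [sq_nonneg B]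
  have hm2 : B ^ 2 * ((α * Real.exp 1) ^ c * ε⁻¹ * L ^ c) ≤ m := by nlinarith [sq_nonneg B]
  have hm0 : 0 < m := lt_of_lt_of_le (by positivity) hm1
  have F1 : 2 * Real.log B + (2 * c * (Real.log 2 + Real.log α) - 2 * Real.log ε + Real.log L)
      ≤ Real.log m := by
    refine le_trans (le_of_eq ?_) (Real.log_le_log (by positivity) hm1)
    rw [Real.log_mul (by positivity) (by positivity), Real.log_mul (by positivity) (by positivity),
      Real.log_mul (by positivity) (by positivity), Real.log_inv, Real.log_pow, Real.log_pow,
      Real.log_pow, Real.log_mul (by positivity) (by positivity)]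
    push_cast; ring
  have F2 : 2 * Real.log B + (c * (Real.log α + 1) - Real.log ε + c * Real.log L)
      ≤ Real.log m := by
    refine le_trans (le_of_eq ?_) (Real.log_le_log (by positivity) hm2)
    rw [Real.log_mul (by positivity) (by positivity), Real.log_mul (by positivity) (by positivity),
      Real.log_mul (by positivity) (by positivity), Real.log_inv, Real.log_pow, Real.log_pow,
      Real.log_pow, Real.log_mul (by positivity) (by positivity), Real.log_exp]
    push_cast; ring
  have F3 := log_le_log_two_add hs0
  have hlB : 0 ≤ Real.log B := Real.log_nonneg hB
  have hlsp : Real.log s ≤ Real.log p := Real.log_le_log hs0 hsp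
  have hlpL : Real.log p ≤ Real.log L := Real.log_le_log hp0 hpL
  have hls : 0 ≤ Real.log s := Real.log_nonneg (by linarith)
  rw [← Real.log_le_log_iff (by positivity) (by positivity), Real.log_rpow (by positivity),
    Real.log_mul (by positivity) (by positivity), Real.log_mul (by positivity) (by positivity),
    Real.log_rpow (by positivity), Real.log_rpow (by positivity),
    Real.log_div (by positivity) (by positivity), Real.log_div (by positivity) (by positivity),
    Real.log_div (by positivity) (by positivity), Real.log_mul (by positivity) (by positivity),
    Real.log_mul (by positivity) (by positivity), Real.log_mul (by positivity) (by positivity),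
    Real.log_sqrt (by positivity), Real.log_div (by positivity) (by positivity)]
  generalize Real.log m = lm at *
  generalize Real.log L = lL at *
  generalize Real.log p = lp at *
  generalize Real.log s = ls at *
  generalize Real.log α = la at *
  generalize Real.log B = lB at *
  generalize Real.log ε = le at *
  generalize Real.log 2 = l2 at *
  -- In logarithms the goal is linear in log m with coefficient s - 1: use F1 once and F2 with
  -- weight s - 2. By F3 the coefficient of c in what remains is nonnegative, so the case c = 1 is
  -- the worst.
  have G2 := mul_le_mul_of_nonneg_left F2 (by linarith : 0 ≤ s - 2)
  have bracket : (s - 2) * (lL - ls) ≤ 2 * l2 + (s - 2) * (1 + lL) - s * ls := by nlinarith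
  have hb0 : 0 ≤ (s - 2) * (lL - ls) := mul_nonneg (by linarith) (by linarith)
  have bracket' : (s - 2) * (lL - ls) ≤ c * (2 * l2 + (s - 2) * (1 + lL) - s * ls) := by nlinarith
  have G3 : 0 ≤ (s - 2) * (lL - lp) := mul_nonneg (by linarith) (by linarith)
  have G4 : 0 ≤ (s - 2) * lB := mul_nonneg (by linarith) hlB
  nlinarith

theorem pow_div_factorial_le {p : ℝ} (hp : 0 ≤ p) {k : ℕ} (hk : 0 < k) :
    p ^ k / k.factorial ≤ (Real.exp 1 * (p / k)) ^ k := by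
  have h := Real.pow_div_factorial_le_exp (k : ℝ) (by positivity) k
  rw [mul_pow, ← Real.exp_nat_mul, mul_one, div_pow]
  have hk' : (0 : ℝ) < (k : ℝ) ^ k := by positivity
  calc p ^ k / k.factorial = (k : ℝ) ^ k / k.factorial * (p ^ k / (k : ℝ) ^ k) := by
        field_simp
    _ ≤ _ := by gcongr

theorem sum_Icc_quarter_pow_le (n : ℕ) :
    ∑ k ∈ Finset.Icc 2 n, (1 / 4 : ℝ) ^ k ≤ 1 / 3 := by
  have h : ∀ n : ℕ, ∑ k ∈ Finset.Icc 2 n, (1 / 4 : ℝ) ^ k ≤ 1 / 3 - (1 / 4) ^ n / 3 := by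
    intro n
    induction n with
    | zero => norm_num
    | succ n ih =>
      rcases Nat.lt_or_ge n 1 with h | h
      · obtain rfl : n = 0 := by omega
        norm_num
      · rw [Finset.sum_Icc_succ_top (by omega), pow_succ]
        linarith
  exact (h n).trans (by linarith [show (0 : ℝ) ≤ (1 / 4) ^ n by positivity])

/-- Relative to p/m, the k-th term of the sum is at most 4^(-k) and the remainder at most 1/4, for a
total of at most 2 · 1/3 + 1/4 < 1. -/
theorem momentIncrement_le {Ω : Type*} [MeasurableSpace Ω] {P : Measure Ω} {Z : Ω → ℝ}
    {ε L a m p B : ℝ} {c : ℕ} (hε : 0 < ε) (ha : 0 < a) (hc : 1 ≤ c)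
    (hB : 8 * Real.exp 3 ≤ B) (hp : 2 ≤ p) (hpL : p ≤ L)
    (hm : B ^ 2 * ((4 * a) ^ (2 * c) * (ε ^ 2)⁻¹ * L
      + (2 * a * Real.exp 1) ^ c * ε⁻¹ * L ^ c) ≤ m)
    (hZ : ∀ s : ℝ, 2 ≤ s → s ≤ p → ∫ ω, |Z ω| ^ s ∂P ≤ 2 ^ s * (2 * a * s) ^ (c * s)) :
    momentIncrement P p (m * ε * √(p / L) / Real.exp 2) Z ≤ p / m := by
  have hp0 : 0 < p := by linarith
  have hL0 : 0 < L := by linarith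
  have hB1 : 1 ≤ B := by linarith [Real.add_one_le_exp (3 : ℝ)]
  have hm0 : 0 < m := lt_of_lt_of_le (by positivity) hm
  set W := m * ε * √(p / L) with hW
  have hW0 : 0 < W := by positivity
  -- Origin of 8e³: a factor e from k! ≥ (k/e)^k (or from e^p), a 2 from centering the square, an e²
  -- from the scale, and a 4 for the geometric ratio.
  have hratio : Real.exp 1 * (2 * (Real.exp 2 / B)) ≤ 1 / 4 := by
    rw [← mul_assoc, ← mul_div_assoc, div_le_iff₀ (by linarith),
      show Real.exp 1 * 2 * Real.exp 2 = 2 * Real.exp 3 by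
        rw [mul_right_comm, ← Real.exp_add]; norm_num; ring]
    linarith
  have key : ∀ s : ℝ, 2 ≤ s → s ≤ p →
      (p / s) ^ s * ((∫ ω, |Z ω| ^ s ∂P) / (W / Real.exp 2) ^ s) * (m / p)
        ≤ (2 * (Real.exp 2 / B)) ^ s := by
    intro s hs hsp
    have hs0 : 0 < s := by linarith
    have h := rpow_moment_term_le hε ha hc hB1 hs hsp hpL hm
    rw [← hW] at h
    have hWs : 0 < (W / Real.exp 2) ^ s := by positivity
    calc (p / s) ^ s * ((∫ ω, |Z ω| ^ s ∂P) / (W / Real.exp 2) ^ s) * (m / p)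
        ≤ (p / s) ^ s * (2 ^ s * (2 * a * s) ^ (c * s) / (W / Real.exp 2) ^ s) * (m / p) := by
          gcongr; exact hZ s hs hsp
      _ = 2 ^ s * ((p / s) ^ s * (2 * a * s) ^ (c * s) * (m / p)) / (W / Real.exp 2) ^ s := by ring
      _ ≤ 2 ^ s * (W / B) ^ s / (W / Real.exp 2) ^ s := by gcongr
      _ = (2 * (Real.exp 2 / B)) ^ s := by
          rw [← Real.mul_rpow (by positivity) (by positivity),
            ← Real.div_rpow (by positivity) (by positivity)]
          congr 1
          field_simp
  have hlast : Real.exp p * ((∫ ω, |Z ω| ^ p ∂P) / (W / Real.exp 2) ^ p) * (m / p) ≤ 1 / 4 := by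
    have h := key p hp le_rfl
    rw [div_self hp0.ne', Real.one_rpow, one_mul] at h
    calc _ = Real.exp p * ((∫ ω, |Z ω| ^ p ∂P) / (W / Real.exp 2) ^ p * (m / p)) := by ring
      _ ≤ Real.exp p * (2 * (Real.exp 2 / B)) ^ p := by gcongr
      _ = (Real.exp 1 * (2 * (Real.exp 2 / B))) ^ p := by
          rw [Real.mul_rpow (x := Real.exp 1) (by positivity) (by positivity), ← Real.exp_mul,
            one_mul]
      _ ≤ (1 / 4) ^ p := Real.rpow_le_rpow (by positivity) hratio hp0.le
      _ ≤ (1 / 4) ^ (1 : ℝ) :=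
          Real.rpow_le_rpow_of_exponent_ge (by norm_num) (by norm_num) (by linarith)
      _ = 1 / 4 := by norm_num
  have hsum : (∑ k ∈ Finset.Icc 2 ⌊p⌋₊,
      p ^ k / k.factorial * ((∫ ω, |Z ω| ^ k ∂P) / (W / Real.exp 2) ^ k)) * (m / p) ≤ 1 / 3 := by
    rw [Finset.sum_mul]
    refine (Finset.sum_le_sum fun k hk => ?_).trans (sum_Icc_quarter_pow_le ⌊p⌋₊)
    obtain ⟨hk2, hkp⟩ := Finset.mem_Icc.1 hk
    have hk2' : (2 : ℝ) ≤ k := by exact_mod_cast hk2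
    have h := key k hk2' ((Nat.le_floor_iff hp0.le).1 hkp)
    simp only [Real.rpow_natCast] at h
    have hint : 0 ≤ ∫ ω, |Z ω| ^ k ∂P := integral_nonneg fun ω => by positivity
    calc p ^ k / k.factorial * ((∫ ω, |Z ω| ^ k ∂P) / (W / Real.exp 2) ^ k) * (m / p)
        ≤ (Real.exp 1 * (p / k)) ^ k * ((∫ ω, |Z ω| ^ k ∂P) / (W / Real.exp 2) ^ k)
          * (m / p) := by
          gcongr
          exact pow_div_factorial_le hp0.le (by omega)
      _ = Real.exp 1 ^ k * ((p / k) ^ k * ((∫ ω, |Z ω| ^ k ∂P) / (W / Real.exp 2) ^ k)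
          * (m / p)) := by rw [mul_pow]; ring
      _ ≤ Real.exp 1 ^ k * (2 * (Real.exp 2 / B)) ^ k := by gcongr
      _ = (Real.exp 1 * (2 * (Real.exp 2 / B))) ^ k := (mul_pow _ _ _).symm
      _ ≤ (1 / 4) ^ k := by gcongr
  have htot : momentIncrement P p (W / Real.exp 2) Z * (m / p) ≤ 1 := by
    unfold momentIncrement
    rw [add_mul, mul_assoc]
    linarith
  rwa [← le_div_iff₀ (by positivity), one_div_div] at htot

/-! ### Moments of tensor forms -/

section TensorForm

variable {ι : Type*} [Fintype ι]

/-- The inner product of `x` with the tensor product of the vectors `t 0, …, t (c - 1)`. -/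
noncomputable def tensorForm {c : ℕ} (x : (Fin c → ι) → ℝ) (t : Fin c → ι → ℝ) : ℝ :=
  ∑ J, (∏ k, t k (J k)) * x J

theorem sum_fin_succ_fun {c : ℕ} {M : Type*} [AddCommMonoid M] (f : (Fin (c + 1) → ι) → M) :
    ∑ J, f J = ∑ j, ∑ J : Fin c → ι, f (Fin.cons j J) := by
  rw [← Fintype.sum_prod_type', ← (Fin.consEquiv fun _ => ι).sum_comp]
  rfl

theorem tensorForm_cons {c : ℕ} (x : (Fin (c + 1) → ι) → ℝ) (u : ι → ℝ) (t : Fin c → ι → ℝ) :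
    tensorForm x (Fin.cons u t) = ∑ j, u j * tensorForm (fun J => x (Fin.cons j J)) t := by
  simp only [tensorForm, sum_fin_succ_fun, Fin.prod_univ_succ, Fin.cons_zero, Fin.cons_succ,
    Finset.mul_sum, mul_assoc]

@[fun_prop]
theorem measurable_tensorForm {c : ℕ} (x : (Fin c → ι) → ℝ) : Measurable (tensorForm x) := by
  unfold tensorForm
  fun_prop

theorem lintegral_pi_succ {E : Type*} [MeasurableSpace E] (μ : Measure E) [IsProbabilityMeasure μ]
    {c : ℕ} {g : (Fin (c + 1) → E) → ENNReal} (hg : Measurable g) :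
    ∫⁻ t, g t ∂Measure.pi (fun _ => μ)
      = ∫⁻ t', ∫⁻ u, g (Fin.cons u t') ∂μ ∂Measure.pi (fun _ : Fin c => μ) := by
  have h := (measurePreserving_piFinSuccAbove (fun _ : Fin (c + 1) => μ) 0).symm
  rw [← h.lintegral_comp hg]
  refine (lintegral_prod_symm' _ (hg.comp h.measurable)).trans ?_
  simp [MeasurableEquiv.piFinSuccAbove, Fin.insertNthEquiv, Fin.insertNth_zero']

theorem lintegral_sum_rpow_le {α κ : Type*} [MeasurableSpace α] {μ : Measure α} {r : ℝ}
    (hr : 1 ≤ r) {f : κ → α → ENNReal} {C : κ → ENNReal} (hf : ∀ j, Measurable (f j))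
    (hC : ∀ j, ∫⁻ a, f j a ^ r ∂μ ≤ C j ^ r) (s : Finset κ) :
    ∫⁻ a, (∑ j ∈ s, f j a) ^ r ∂μ ≤ (∑ j ∈ s, C j) ^ r := by
  classical
  have hr0 : 0 < r := by linarith
  induction s using Finset.induction_on with
  | empty => simp [hr0]
  | insert i s hi ih =>
    simp only [Finset.sum_insert hi]
    have h := ENNReal.lintegral_Lp_add_le (μ := μ) (hf i).aemeasurable
      (Finset.measurable_fun_sum s fun j _ => hf j).aemeasurable hr
    rw [← ENNReal.rpow_inv_le_iff hr0, ← one_div]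
    refine h.trans (add_le_add ?_ ?_)
    · rw [one_div, ENNReal.rpow_inv_le_iff hr0]; exact hC i
    · rw [one_div, ENNReal.rpow_inv_le_iff hr0]; exact ih

variable {μ : Measure (ι → ℝ)} [IsProbabilityMeasure μ]

/-- Moment bounds for linear forms tensorise. -/
theorem lintegral_tensorForm_rpow_le {r D : ℝ} (hr : 1 ≤ r) (hD : 0 ≤ D)
    (h : ∀ x : ι → ℝ, ∫⁻ u, ENNReal.ofReal ((∑ j, u j * x j) ^ 2) ^ r ∂μ
      ≤ ENNReal.ofReal (D * ∑ j, x j ^ 2) ^ r) {c : ℕ} (x : (Fin c → ι) → ℝ) :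
    ∫⁻ t, ENNReal.ofReal (tensorForm x t ^ 2) ^ r ∂Measure.pi (fun _ => μ)
      ≤ ENNReal.ofReal (D ^ c * ∑ J, x J ^ 2) ^ r := by
  have hr0 : 0 < r := by linarith
  induction c with
  | zero => simp [tensorForm]
  | succ c ih =>
    rw [lintegral_pi_succ μ (by fun_prop)]
    simp only [tensorForm_cons]
    -- With the other factors fixed, the form is linear in the first one; its moment bound leaves a
    -- sum of squares of shorter tensor forms.
    refine (lintegral_mono fun t' => h _).trans ?_
    simp only [ENNReal.ofReal_mul hD, ENNReal.mul_rpow_of_nonneg _ _ hr0.le]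
    rw [lintegral_const_mul _ (by fun_prop), pow_succ', mul_assoc, ENNReal.ofReal_mul hD,
      ENNReal.mul_rpow_of_nonneg _ _ hr0.le]
    gcongr
    simp only [ENNReal.ofReal_sum_of_nonneg fun j _ => sq_nonneg _]
    -- Minkowski in L^r is applied to the squares, so the squared norms of the slices of x add up
    -- exactly.
    refine (lintegral_sum_rpow_le hr (fun j => by fun_prop) (fun j => ih _) Finset.univ).trans ?_
    rw [sum_fin_succ_fun, Finset.mul_sum, ENNReal.ofReal_sum_of_nonneg fun j _ => by positivity]

theorem lintegral_tensorForm_sq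
    (h : ∀ x : ι → ℝ, ∫⁻ u, ENNReal.ofReal ((∑ j, u j * x j) ^ 2) ∂μ
      = ENNReal.ofReal (∑ j, x j ^ 2)) {c : ℕ} (x : (Fin c → ι) → ℝ) :
    ∫⁻ t, ENNReal.ofReal (tensorForm x t ^ 2) ∂Measure.pi (fun _ => μ)
      = ENNReal.ofReal (∑ J, x J ^ 2) := by
  induction c with
  | zero => simp [tensorForm]
  | succ c ih =>
    rw [lintegral_pi_succ μ (by fun_prop)]
    simp only [tensorForm_cons, h]
    simp only [ENNReal.ofReal_sum_of_nonneg fun j _ => sq_nonneg _]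
    rw [lintegral_finsetSum _ fun j _ => by fun_prop]
    simp only [ih, sum_fin_succ_fun (c := c)]
    simp only [ENNReal.ofReal_sum_of_nonneg fun j _ => sq_nonneg _]

end TensorForm

/-! ### From independent matrices to independent tuples of rows -/

section Independence

/-- Exchanging the two indices of a product of copies of `μ`. -/
theorem map_swap_pi_pi {ι κ E : Type*} [Fintype ι] [Fintype κ] [MeasurableSpace E]
    (μ : Measure E) [IsProbabilityMeasure μ] :
    (Measure.pi fun _ : κ => Measure.pi fun _ : ι => μ).map (fun t i k => t k i)
      = Measure.pi fun _ : ι => Measure.pi fun _ : κ => μ := by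
  symm
  -- It suffices to test boxes whose sides are themselves boxes; on these, both measures are the
  -- same double product.
  refine Measure.pi_eq_generateFrom
    (C := fun _ => Set.pi Set.univ '' Set.pi Set.univ fun _ => { s : Set E | MeasurableSet s })
    (fun _ => generateFrom_pi) (fun _ => isPiSystem_pi)
    (fun _ => Measure.FiniteSpanningSetsIn.pi fun _ => μ.toFiniteSpanningSetsIn) fun s hs => ?_
  choose f hf hfs using hs
  have hf' : ∀ i k, MeasurableSet (f i k) := fun i k => hf i k (Set.mem_univ k)
  have hpre : (fun (t : κ → ι → E) i k => t k i) ⁻¹' Set.pi Set.univ s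
      = Set.pi Set.univ fun k => Set.pi Set.univ fun i => f i k := by
    ext t
    simp only [← hfs, Set.mem_preimage, Set.mem_pi, Set.mem_univ, true_implies]
    exact forall_comm
  rw [Measure.map_apply (by fun_prop)
    (MeasurableSet.univ_pi fun i => hfs i ▸ MeasurableSet.univ_pi (hf' i)), hpre]
  simp only [← hfs, Measure.pi_pi]
  exact Finset.prod_comm

variable {Ω : Type*} [MeasurableSpace Ω] {P : Measure Ω} [IsProbabilityMeasure P]
  {ι κ E : Type*} [Fintype ι] [Fintype κ] [MeasurableSpace E]

/-- If `S k` (`k : κ`) are independent, each with iid entries of law `μ`, then the tuples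
`(S k i)_k` (`i : ι`) are independent and distributed according to a power of `μ`. -/
theorem iIndepFun_swap {μ : Measure E} [IsProbabilityMeasure μ] {S : κ → Ω → ι → E}
    (hS : ∀ k, AEMeasurable (S k) P) (hind : iIndepFun S P)
    (hlaw : ∀ k, P.map (S k) = Measure.pi fun _ => μ) :
    iIndepFun (fun (i : ι) ω k => S k ω i) P ∧
      ∀ i, P.map (fun ω k => S k ω i) = Measure.pi fun _ => μ := by
  have hm : ∀ i, AEMeasurable (fun ω k => S k ω i) P := fun i =>
    aemeasurable_pi_lambda _ fun k => (measurable_pi_apply i).comp_aemeasurable (hS k)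
  have hjoint : P.map (fun ω (i : ι) k => S k ω i) = Measure.pi fun _ => Measure.pi fun _ => μ := by
    have h := hind.map_fun_eq_pi_map hS
    simp only [hlaw] at h
    rw [← map_swap_pi_pi (κ := κ) (ι := ι) μ, ← h,
      AEMeasurable.map_map_of_aemeasurable (Measurable.aemeasurable (by fun_prop))
        (aemeasurable_pi_lambda _ hS)]
    rfl
  have hmarg : ∀ i, P.map (fun ω k => S k ω i) = Measure.pi fun _ => μ := fun i => by
    rw [← (measurePreserving_eval (fun _ : ι => Measure.pi fun _ : κ => μ) i).map_eq, ← hjoint,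
      AEMeasurable.map_map_of_aemeasurable (measurable_pi_apply i).aemeasurable
        (aemeasurable_pi_lambda _ hm)]
    rfl
  refine ⟨(iIndepFun_iff_map_fun_eq_pi_map hm).2 ?_, hmarg⟩
  simp only [hmarg]
  exact hjoint

end Independence

/-! ### Passing between integrals, lower integrals and L^p norms -/

section Conversions

variable {Ω : Type*} [MeasurableSpace Ω] {P : Measure Ω}

theorem lintegral_ofReal_sq_rpow_le {Y : Ω → ℝ} {r D N : ℝ} (hr : 0 < r) (hD : 0 ≤ D) (hN : 0 ≤ N)
    (h : eLpNorm Y (ENNReal.ofReal (2 * r)) P ≤ ENNReal.ofReal (√D * N)) :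
    ∫⁻ ω, ENNReal.ofReal (Y ω ^ 2) ^ r ∂P ≤ ENNReal.ofReal (D * N ^ 2) ^ r := by
  have h2r : 0 < 2 * r := by positivity
  rw [eLpNorm_eq_lintegral_rpow_enorm_toReal (by simpa using hr) ENNReal.ofReal_ne_top,
    ENNReal.toReal_ofReal h2r.le, one_div, ENNReal.rpow_inv_le_iff h2r] at h
  have e : ∀ y : ℝ, 0 ≤ y → ENNReal.ofReal y ^ (2 * r) = ENNReal.ofReal (y ^ 2) ^ r := fun y hy => by
    rw [ENNReal.rpow_mul, ENNReal.rpow_two, ENNReal.ofReal_pow hy]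
  rw [e _ (by positivity), mul_pow, Real.sq_sqrt hD] at h
  refine le_trans (le_of_eq (lintegral_congr fun ω => ?_)) h
  rw [Real.enorm_eq_ofReal_abs, e _ (abs_nonneg _), sq_abs]

theorem integrable_and_integral_of_lintegral_ofReal {X : Ω → ℝ} {b : ℝ} (hX : AEMeasurable X P)
    (hX0 : ∀ ω, 0 ≤ X ω) (hb : 0 ≤ b) (h : ∫⁻ ω, ENNReal.ofReal (X ω) ∂P ≤ ENNReal.ofReal b) :
    Integrable X P ∧ ∫ ω, X ω ∂P ≤ b := by
  refine ⟨⟨hX.aestronglyMeasurable, ?_⟩, ?_⟩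
  · rw [hasFiniteIntegral_iff_ofReal (Filter.Eventually.of_forall hX0)]
    exact h.trans_lt ENNReal.ofReal_lt_top
  · rw [integral_eq_lintegral_of_nonneg_ae (Filter.Eventually.of_forall hX0)
      hX.aestronglyMeasurable]
    exact ENNReal.toReal_le_of_le_ofReal hb h

theorem integrable_and_integral_eq_of_lintegral_ofReal {X : Ω → ℝ} {b : ℝ} (hX : AEMeasurable X P)
    (hX0 : ∀ ω, 0 ≤ X ω) (hb : 0 ≤ b) (h : ∫⁻ ω, ENNReal.ofReal (X ω) ∂P = ENNReal.ofReal b) :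
    Integrable X P ∧ ∫ ω, X ω ∂P = b := by
  refine ⟨(integrable_and_integral_of_lintegral_ofReal hX hX0 hb h.le).1, ?_⟩
  rw [integral_eq_lintegral_of_nonneg_ae (Filter.Eventually.of_forall hX0) hX.aestronglyMeasurable,
    h, ENNReal.toReal_ofReal hb]

/-- Pointwise |w² - 1|^s ≤ w^(2s) + 1, and Q ≥ 1 lets Q^s absorb the 1. -/
theorem integral_abs_sq_sub_one_rpow_le [IsProbabilityMeasure P] {W : Ω → ℝ} {s Q : ℝ}
    (hW : AEMeasurable W P) (hs : 1 ≤ s) (hQ : 1 ≤ Q)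
    (h : ∫⁻ ω, ENNReal.ofReal (W ω ^ 2) ^ s ∂P ≤ ENNReal.ofReal Q ^ s) :
    Integrable (fun ω => |W ω ^ 2 - 1| ^ s) P ∧ ∫ ω, |W ω ^ 2 - 1| ^ s ∂P ≤ 2 ^ s * Q ^ s := by
  have hs0 : 0 < s := by linarith
  simp only [ENNReal.ofReal_rpow_of_nonneg (sq_nonneg _) hs0.le] at h
  rw [ENNReal.ofReal_rpow_of_nonneg (by linarith) hs0.le] at h
  obtain ⟨hi, hle⟩ := integrable_and_integral_of_lintegral_ofReal ((hW.pow_const 2).pow_const s)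
    (fun ω => by positivity) (by positivity) h
  have hbound : ∀ ω, |W ω ^ 2 - 1| ^ s ≤ (W ω ^ 2) ^ s + 1 := fun ω => by
    rcases le_total (W ω ^ 2) 1 with h1 | h1
    · have : |W ω ^ 2 - 1| ^ s ≤ 1 := by
        refine Real.rpow_le_one (abs_nonneg _) ?_ hs0.le
        rw [abs_le]
        constructor <;> linarith [sq_nonneg (W ω)]
      exact this.trans (le_add_of_nonneg_left (by positivity))
    · have : |W ω ^ 2 - 1| ^ s ≤ (W ω ^ 2) ^ s := by
        refine Real.rpow_le_rpow (abs_nonneg _) ?_ hs0.le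
        rw [abs_of_nonneg (by linarith)]
        linarith
      linarith
  have hi' := hi.add (integrable_const (μ := P) (1 : ℝ))
  have hint : Integrable (fun ω => |W ω ^ 2 - 1| ^ s) P := by
    refine hi'.mono' ((continuous_abs.measurable.comp_aemeasurable
      ((hW.pow_const 2).sub_const 1)).pow_const s).aestronglyMeasurable
      (Filter.Eventually.of_forall fun ω => ?_)
    rw [Real.norm_of_nonneg (by positivity)]
    exact hbound ω
  refine ⟨hint, (integral_mono hint hi' hbound).trans ?_⟩
  simp only [Pi.add_apply]
  rw [integral_add hi (integrable_const _)]
  have h1 : 1 ≤ Q ^ s := Real.one_le_rpow hQ hs0.le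
  have h2 : (2 : ℝ) ≤ 2 ^ s := by
    simpa using Real.rpow_le_rpow_of_exponent_le (one_le_two (α := ℝ)) hs
  simp only [integral_const, probReal_univ, smul_eq_mul, mul_one]
  nlinarith

theorem eLpNorm_le_of_integral_abs_rpow_le {V : Ω → ℝ} {p R : ℝ} (hp : 0 < p) (hR : 0 ≤ R)
    (hi : Integrable (fun ω => |V ω| ^ p) P) (h : ∫ ω, |V ω| ^ p ∂P ≤ R ^ p) :
    eLpNorm V (ENNReal.ofReal p) P ≤ ENNReal.ofReal R := by
  rw [eLpNorm_eq_lintegral_rpow_enorm_toReal (by simpa using hp) ENNReal.ofReal_ne_top,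
    ENNReal.toReal_ofReal hp.le, one_div, ENNReal.rpow_inv_le_iff hp,
    ENNReal.ofReal_rpow_of_nonneg hR hp.le]
  refine le_trans (le_of_eq ?_) (ENNReal.ofReal_le_ofReal h)
  rw [ofReal_integral_eq_lintegral_ofReal hi (Filter.Eventually.of_forall fun ω => by positivity)]
  refine lintegral_congr fun ω => ?_
  rw [Real.enorm_eq_ofReal_abs, ENNReal.ofReal_rpow_of_nonneg (abs_nonneg _) hp.le]

end Conversions

/-! ### Assembly for the face-splitting product -/

theorem sqNormMulVec_smul_faceSplitting {c m d : ℕ} (A : Fin c → Matrix (Fin m) (Fin d) ℝ)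
    (x : EuclideanSpace ℝ (Fin c → Fin d)) :
    sqNormMulVec ((√(m : ℝ))⁻¹ • faceSplitting A) x
      = (m : ℝ)⁻¹ * ∑ i, tensorForm (fun J => x J) (fun k j => A k i j) ^ 2 := by
  rw [sqNormMulVec, EuclideanSpace.norm_sq_eq, Finset.mul_sum]
  refine Finset.sum_congr rfl fun i _ => ?_
  rw [Matrix.smul_mulVec]
  change ‖(√(m : ℝ))⁻¹ * tensorForm (fun J => x J) (fun k j => A k i j)‖ ^ 2 = _
  rw [Real.norm_eq_abs, sq_abs, mul_pow, inv_pow, Real.sq_sqrt (Nat.cast_nonneg m)]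

theorem aemeasurable_faceSplitting {Ω : Type*} [MeasurableSpace Ω] {P : Measure Ω} {c m d : ℕ}
    {S : Fin c → Ω → Matrix (Fin m) (Fin d) ℝ} (hS : ∀ k, AEMeasurable (S k) P) (b : ℝ) :
    AEMeasurable (fun ω => b • faceSplitting (fun k => S k ω)) P := by
  refine aemeasurable_pi_lambda _ fun i => aemeasurable_pi_lambda _ fun J => ?_
  change AEMeasurable (fun ω => b * ∏ k, S k ω i (J k)) P
  refine AEMeasurable.const_mul (Finset.aemeasurable_fun_prod _ fun k _ => ?_) b
  exact (measurable_pi_apply (J k)).comp_aemeasurable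
    ((measurable_pi_apply i).comp_aemeasurable (hS k))

/-- The moment bound for the average of the squares of `m` independent tensor forms, the factors
of which have a law `μ` with subgaussian one-dimensional marginals. -/
theorem eLpNorm_average_tensorForm_sq_sub_one_le {Ω : Type*} [MeasurableSpace Ω] {P : Measure Ω}
    [IsProbabilityMeasure P] {c m d : ℕ} {μ : Measure (Fin d → ℝ)} [IsProbabilityMeasure μ]
    {a ε L p B : ℝ} (hε : 0 < ε) (ha : 1 ≤ 2 * a) (hc : 1 ≤ c) (hm0 : 0 < m)
    (hB : 8 * Real.exp 3 ≤ B) (hp : 2 ≤ p) (hpL : p ≤ L)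
    (hm : B ^ 2 * ((4 * a) ^ (2 * c) * (ε ^ 2)⁻¹ * L
      + (2 * a * Real.exp 1) ^ c * ε⁻¹ * L ^ c) ≤ m)
    (hsq : ∀ x : Fin d → ℝ, ∫⁻ u, ENNReal.ofReal ((∑ j, u j * x j) ^ 2) ∂μ
      = ENNReal.ofReal (∑ j, x j ^ 2))
    (hmom : ∀ r : ℝ, 1 ≤ r → ∀ x : Fin d → ℝ,
      ∫⁻ u, ENNReal.ofReal ((∑ j, u j * x j) ^ 2) ^ r ∂μ
        ≤ ENNReal.ofReal (2 * a * r * ∑ j, x j ^ 2) ^ r)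
    {R : Fin m → Ω → Fin c → Fin d → ℝ} (hR : ∀ i, AEMeasurable (R i) P) (hind : iIndepFun R P)
    (hlaw : ∀ i, P.map (R i) = Measure.pi fun _ => μ)
    {x : (Fin c → Fin d) → ℝ} (hx : ∑ J, x J ^ 2 = 1) :
    eLpNorm (fun ω => (m : ℝ)⁻¹ * ∑ i, tensorForm x (R i ω) ^ 2 - 1) (ENNReal.ofReal p) P
      ≤ ENNReal.ofReal (ε / Real.exp 1 * √(p / L)) := by
  have hp0 : 0 < p := by linarith
  have hL0 : 0 < L := by linarith
  have ha0 : 0 < a := by linarith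
  have hm0' : (0 : ℝ) < m := by exact_mod_cast hm0
  have hW : ∀ i, AEMeasurable (fun ω => tensorForm x (R i ω)) P := fun i =>
    (measurable_tensorForm x).comp_aemeasurable (hR i)
  have hlint : ∀ i (g : ℝ → ENNReal), Measurable g → ∫⁻ ω, g (tensorForm x (R i ω)) ∂P
      = ∫⁻ t, g (tensorForm x t) ∂Measure.pi fun _ => μ := fun i g hg => by
    rw [← hlaw i]
    exact (lintegral_map' (hg.comp (measurable_tensorForm x)).aemeasurable (hR i)).symm
  set Z : Fin m → Ω → ℝ := fun i ω => tensorForm x (R i ω) ^ 2 - 1 with hZdef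
  have hZm : ∀ i, AEMeasurable (Z i) P := fun i => ((hW i).pow_const 2).sub_const 1
  have hZind : iIndepFun Z P :=
    hind.comp (fun _ t => tensorForm x t ^ 2 - 1) fun _ => by fun_prop
  have hZ0 : ∀ i, ∫ ω, Z i ω ∂P = 0 := fun i => by
    have h1 : ∫⁻ ω, ENNReal.ofReal (tensorForm x (R i ω) ^ 2) ∂P = ENNReal.ofReal 1 := by
      rw [hlint i (fun y => ENNReal.ofReal (y ^ 2)) (by fun_prop), lintegral_tensorForm_sq hsq, hx]
    have h2 := integrable_and_integral_eq_of_lintegral_ofReal ((hW i).pow_const 2)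
      (fun ω => sq_nonneg _) zero_le_one h1
    rw [hZdef]
    simp only
    rw [integral_sub h2.1 (integrable_const _), h2.2]
    simp
  have hZs : ∀ i (s : ℝ), 2 ≤ s → Integrable (fun ω => |Z i ω| ^ s) P ∧
      ∫ ω, |Z i ω| ^ s ∂P ≤ 2 ^ s * (2 * a * s) ^ (c * s) := fun i s hs => by
    have h1 : ∫⁻ ω, ENNReal.ofReal (tensorForm x (R i ω) ^ 2) ^ s ∂P
        ≤ ENNReal.ofReal ((2 * a * s) ^ c) ^ s := by
      rw [hlint i (fun y => ENNReal.ofReal (y ^ 2) ^ s) (by fun_prop)]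
      refine (lintegral_tensorForm_rpow_le (by linarith) (by positivity)
        (hmom s (by linarith)) x).trans_eq ?_
      rw [hx, mul_one]
    have h2 := integral_abs_sq_sub_one_rpow_le (hW i) (by linarith)
      (one_le_pow₀ (by nlinarith)) h1
    rwa [← Real.rpow_natCast_mul (by positivity)] at h2
  set τ : ℝ := m * ε * √(p / L) / Real.exp 2 with hτ
  have hτ0 : 0 < τ := by positivity
  obtain ⟨hi, hle⟩ := integral_abs_sum_rpow_le hp hτ0 (b := p / m) (by positivity) hZm hZind
    (fun i => (hZs i p hp).1) hZ0
    (fun i => momentIncrement_le hε ha0 hc hB hp hpL hm fun s hs _ => (hZs i s hs).2) Finset.univ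
  have hV : ∀ ω, (m : ℝ)⁻¹ * ∑ i, tensorForm x (R i ω) ^ 2 - 1 = (m : ℝ)⁻¹ * ∑ i, Z i ω := by
    intro ω
    simp only [hZdef, Finset.sum_sub_distrib, Finset.sum_const, Finset.card_univ, Fintype.card_fin,
      nsmul_eq_mul, mul_one, mul_sub]
    rw [inv_mul_cancel₀ hm0'.ne']
  have habs : ∀ ω, |(m : ℝ)⁻¹ * ∑ i, tensorForm x (R i ω) ^ 2 - 1| ^ p
      = ((m : ℝ)⁻¹) ^ p * |∑ i, Z i ω| ^ p := fun ω => by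
    rw [hV, abs_mul, abs_of_nonneg (by positivity), Real.mul_rpow (by positivity) (abs_nonneg _)]
  refine eLpNorm_le_of_integral_abs_rpow_le hp0 (by positivity) ?_ ?_
  · simp only [habs]
    exact hi.const_mul _
  · simp only [habs]
    rw [integral_const_mul]
    -- This growth costs one factor e in the L^p norm; the e² in τ leaves the 1/e of the claim.
    have hgrow : (1 + p / m) ^ m ≤ Real.exp 1 ^ p := by
      rw [← Real.exp_mul, one_mul]
      calc (1 + p / m) ^ m ≤ Real.exp (p / m) ^ m := by
            gcongr
            linarith [Real.add_one_le_exp (p / m)]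
        _ = Real.exp p := by
            rw [← Real.exp_nat_mul]
            congr 1
            field_simp
    rw [Finset.card_univ, Fintype.card_fin] at hle
    calc ((m : ℝ)⁻¹) ^ p * ∫ ω, |∑ i, Z i ω| ^ p ∂P
        ≤ ((m : ℝ)⁻¹) ^ p * (τ ^ p * Real.exp 1 ^ p) := by
          gcongr
          exact hle.trans (by gcongr)
      _ = (ε / Real.exp 1 * √(p / L)) ^ p := by
          rw [← Real.mul_rpow (by positivity) (by positivity),
            ← Real.mul_rpow (by positivity) (by positivity)]
          congr 1
          rw [hτ, show (2 : ℝ) = 1 + 1 by norm_num, Real.exp_add]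
          field_simp

theorem theorem2 :
    ∃ K : ℝ, 0 < K ∧
      ∀ (ε δ : ℝ), 0 < ε → ε ≤ 1 → 0 < δ → δ ≤ 1 →
      ∀ (c m d : ℕ), 1 ≤ c → ∀ (hm : 0 < m) (a : ℝ), 0 < a →
      -- a random matrix `T` with iid rows
      ∀ (Ω : Type*) [MeasurableSpace Ω] (P : Measure Ω) [IsProbabilityMeasure P]
        (T : Ω → Matrix (Fin m) (Fin d) ℝ),
        AEMeasurable T P →
        iIndepFun (fun (i : Fin m) (ω : Ω) => T ω i) P →
        (∀ i : Fin m, IdentDistrib (fun ω => T ω i) (fun ω => T ω ⟨0, hm⟩) P P) →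
        (∀ x : EuclideanSpace ℝ (Fin d),
          ∫ ω, (∑ j, T ω ⟨0, hm⟩ j * x j) ^ 2 ∂P = ‖x‖ ^ 2) →
        (∀ (x : EuclideanSpace ℝ (Fin d)) (p : ℝ), 2 ≤ p →
          eLpNorm (fun ω => ∑ j, T ω ⟨0, hm⟩ j * x j) (ENNReal.ofReal p) P ≤
            ENNReal.ofReal (Real.sqrt (a * p) * ‖x‖)) →
      -- `c` independent copies of `T`
      ∀ (Ω' : Type*) [MeasurableSpace Ω'] (P' : Measure Ω') [IsProbabilityMeasure P']
        (S : Fin c → Ω' → Matrix (Fin m) (Fin d) ℝ),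
        iIndepFun S P' →
        (∀ k : Fin c, IdentDistrib (S k) T P' P) →
        (m : ℝ) ≥ K * ((4 * a) ^ (2 * c) * (ε ^ 2)⁻¹ * Real.log (1 / δ)
            + (2 * a * Real.exp 1) ^ c * ε⁻¹ * Real.log (1 / δ) ^ c) →
        StrongJLMoment
          (fun ω => (Real.sqrt m)⁻¹ • faceSplitting (fun k => S k ω)) P' ε δ := by
  refine ⟨(8 * Real.exp 3) ^ 2, by positivity, ?_⟩
  intro ε δ hε _ _ _ c m d hc hm0 a ha Ω _ P _ T hT hTind hTid hTsq hTmom Ω' _ P' _ S hSind hSid hm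
  have hrow : ∀ i, AEMeasurable (fun ω => T ω i) P := fun i =>
    (measurable_pi_apply i).comp_aemeasurable hT
  set μ : Measure (Fin d → ℝ) := P.map (fun ω => T ω ⟨0, hm0⟩) with hμ
  have : IsProbabilityMeasure μ := Measure.isProbabilityMeasure_map (hrow _)
  have hSlaw : ∀ k, P'.map (S k) = Measure.pi fun _ => μ := fun k => by
    rw [(hSid k).map_eq, ← (funext fun i => (hTid i).map_eq :
      (fun i => P.map fun ω => T ω i) = fun _ => μ)]
    exact hTind.map_fun_eq_pi_map hrow
  obtain ⟨hRind, hRlaw⟩ := iIndepFun_swap (ι := Fin m) (fun k => (hSid k).aemeasurable_fst)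
    hSind hSlaw
  have hRm : ∀ i, AEMeasurable (fun ω k => S k ω i) P' := fun i =>
    aemeasurable_pi_lambda _ fun k =>
      (measurable_pi_apply i).comp_aemeasurable (hSid k).aemeasurable_fst
  have hnorm : ∀ x : Fin d → ℝ, ‖(WithLp.toLp 2 x : EuclideanSpace ℝ (Fin d))‖ ^ 2 = ∑ j, x j ^ 2 :=
    fun x => by simp [EuclideanSpace.norm_sq_eq]
  have hform : ∀ x : Fin d → ℝ, Measurable fun u : Fin d → ℝ => ∑ j, u j * x j := fun x => by
    fun_prop
  have hmom : ∀ r : ℝ, 1 ≤ r → ∀ x : Fin d → ℝ,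
      ∫⁻ u, ENNReal.ofReal ((∑ j, u j * x j) ^ 2) ^ r ∂μ
        ≤ ENNReal.ofReal (2 * a * r * ∑ j, x j ^ 2) ^ r := fun r hr x => by
    rw [hμ, lintegral_map' (Measurable.aemeasurable (by fun_prop)) (hrow _), ← hnorm x]
    refine lintegral_ofReal_sq_rpow_le (by linarith) (by positivity) (norm_nonneg _) ?_
    rw [show 2 * a * r = a * (2 * r) by ring]
    exact hTmom (WithLp.toLp 2 x) (2 * r) (by linarith)
  have hsq : ∀ x : Fin d → ℝ, ∫⁻ u, ENNReal.ofReal ((∑ j, u j * x j) ^ 2) ∂μ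
      = ENNReal.ofReal (∑ j, x j ^ 2) := fun x => by
    -- The Bochner identity for the second moment becomes one of lower integrals only once
    -- integrability is known, which the moment bound at exponent 2 supplies.
    have h1 := hmom 1 le_rfl x
    simp only [ENNReal.rpow_one] at h1
    rw [hμ, lintegral_map' (Measurable.aemeasurable (by fun_prop)) (hrow _)] at h1 ⊢
    have hX : AEMeasurable (fun ω => (∑ j, T ω ⟨0, hm0⟩ j * x j) ^ 2) P :=
      ((hform x).comp_aemeasurable (hrow ⟨0, hm0⟩)).pow_const 2
    have h2 := (integrable_and_integral_of_lintegral_ofReal hX (fun ω => sq_nonneg _)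
      (by positivity) h1).1
    rw [← hnorm x, ← hTsq (WithLp.toLp 2 x)]
    exact (ofReal_integral_eq_lintegral_ofReal h2
      (Filter.Eventually.of_forall fun ω => sq_nonneg _)).symm
  have hunit : ∀ x : EuclideanSpace ℝ (Fin c → Fin d), ‖x‖ = 1 → ∑ J, x J ^ 2 = 1 := fun x hx => by
    have := EuclideanSpace.norm_sq_eq x
    simpa [hx] using this.symm
  have hrowsq : ∀ x : EuclideanSpace ℝ (Fin c → Fin d), ‖x‖ = 1 → ∀ i,
      Integrable (fun ω => tensorForm (fun J => x J) (fun k => S k ω i) ^ 2) P' ∧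
        ∫ ω, tensorForm (fun J => x J) (fun k => S k ω i) ^ 2 ∂P' = 1 := fun x hx i => by
    have h1 := lintegral_tensorForm_sq hsq (fun J => x J)
    rw [hunit x hx, ← hRlaw i, lintegral_map' (by fun_prop) (hRm i)] at h1
    exact integrable_and_integral_eq_of_lintegral_ofReal
      (((measurable_tensorForm _).comp_aemeasurable (hRm i)).pow_const 2) (fun ω => sq_nonneg _)
      zero_le_one h1
  refine ⟨aemeasurable_faceSplitting (fun k => (hSid k).aemeasurable_fst) _, fun x hx => ?_,
    fun x hx => ?_, fun x hx p hp hpL => ?_⟩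
  · simp only [sqNormMulVec_smul_faceSplitting]
    exact (integrable_finsetSum _ fun i _ => (hrowsq x hx i).1).const_mul _
  · simp only [sqNormMulVec_smul_faceSplitting]
    rw [integral_const_mul, integral_finsetSum _ fun i _ => (hrowsq x hx i).1]
    simp only [fun i => (hrowsq x hx i).2, Finset.sum_const, Finset.card_univ, Fintype.card_fin,
      nsmul_eq_mul, mul_one]
    exact inv_mul_cancel₀ (by positivity)
  -- A unit vector x exists, and c ≥ 1, so d > 0; at a basis vector the second moment is 1, while
  -- the moment bound at exponent 2 is 2a. Hence (2as)^c ≥ 1, as centering the squares requires.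
  · have ha1 : 1 ≤ 2 * a := by
      obtain ⟨J⟩ : Nonempty (Fin c → Fin d) := by
        by_contra hne
        rw [not_nonempty_iff] at hne
        simpa using hunit x hx
      have h1 := hmom 1 le_rfl (Pi.single (J ⟨0, hc⟩) 1)
      simp only [ENNReal.rpow_one] at h1
      rw [hsq, ENNReal.ofReal_le_ofReal_iff (by positivity)] at h1
      simpa [Pi.single_apply, ite_pow] using h1
    simp only [sqNormMulVec_smul_faceSplitting]
    exact eLpNorm_average_tensorForm_sq_sub_one_le hε ha1 hc hm0 le_rfl hp hpL hm hsq hmom hRm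
      hRind hRlaw (hunit x hx)
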